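/- Let $M$ be a $C^m$ manifold of dimension $n$ ($m\ge 2$) with a Riemannian metric of class $C^{m-1}$, let $f$ be a $C^\ell$ vector field on $M$, $1\le\ell<m$, with a (complete) $C^\ell$ flow $\Phi=\{\varphi^t\}_{t\in\mathbb R}$, and let $\widehat M=\{x\in M: f(x)\neq 0\}$. Let $\Phi_r=\{\varphi_r^\tau\}_{\tau\in\mathbb R}$ be a $C^\ell$ flow on $\widehat M$ that is a time reparameterization of $\Phi$: for each $x\in\widehat M$ the two orbits of $x$ coincide and have the same orientation, and $\varphi_r^\tau(x)=\varphi^{t(x,\tau)}(x)$, where $t:\widehat M\times\mathbb R\to\mathbb R$ is $C^\ell$, $\tau\mapsto t(x,\tau)$ is strictly increasing and $t(x,\tau_1+\tau_2)=t(x,\tau_1)+t(\varphi_r^{\tau_1}(x),\tau_2)$. Let $r(x)=\big(\partial_\tau t(x,\tau)|_{\tau=0}\big)^{-1}>0$ for $x\in\widehat M$, so that $d\tau=r(x)\,dt$. A point $x$ is Lyapunov regular for a flow $\{\eta^t\}$ if there are numbers $\chi_1<\dots<\chi_k$ and a splitting $T_xM=\bigoplus_{i=1}^k E^i$ into nonzero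 subspaces such that $\lim_{t\to\pm\infty}\frac1t\log\|D_x\eta^t v\|=\chi_i$ for all $v\in E^i\setminus\{0\}$ and all $i$, and $\lim_{t\to\pm\infty}\frac1t\log|\det D_x\eta^t|=\sum_{i}\chi_i\dim E^i$. The Lyapunov exponents at $x$ counted with multiplicity are the numbers $\chi_i$, each repeated $\dim E^i$ times, in increasing order. Denote them by $\lambda_1(x)\le\dots\le\lambda_n(x)$ for $\Phi$ and by $\lambda_1^r(x)\le\dots\le\lambda_n^r(x)$ for $\Phi_r$. Let $\mathcal R\subset\widehat M$ be the set of points $x$ that are Lyapunov regular for $\Phi$ and at which the Lyapunov exponent in the direction of the flow, $\limsup_{t\to\infty}\frac1t\log\|D_x\varphi^t f(x)\|$, is an exponent of multiplicity one. Let $x\in\mathcal R$ be Lyapunov regular for both $\Phi$ and $\Phi_r$, and suppose that the limit $$r_+(x)=\lim_{T\to\infty}\frac1T\int_0^T r(\varphi^s(x))\,ds$$ exists and $0<r_+(x)<\infty$. Then $$\lambda_i^r(x)\,r_+(x)=\lambda_i(x),\qquad i=1,\dots,n,$$ and hence the numbers of positive, of zero and of negative Lyapunov exponents at $x$ (counted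 with multiplicity) are the same for $\Phi$ and for $\Phi_r$. -/

import Mathlib

open scoped Manifold ContDiff Topology
open Set Filter

noncomputable section

namespace TimeChange

variable {n : ℕ} {M : Type*} [TopologicalSpace M]
  [ChartedSpace (EuclideanSpace ℝ (Fin n)) M] [IsManifold (𝓡 n) 1 M]

/-- A Riemannian metric of class `C^p` on the manifold `M` of dimension `n`. -/
abbrev Metric (n : ℕ) (p : WithTop ℕ∞) (M : Type*) [TopologicalSpace M]
    [ChartedSpace (EuclideanSpace ℝ (Fin n)) M] [IsManifold (𝓡 n) 1 M] :=
  Bundle.ContMDiffRiemannianMetric (𝓡 n) p (EuclideanSpace ℝ (Fin n))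
    (fun x : M => TangentSpace (𝓡 n) x)

variable {p : WithTop ℕ∞}

/-- The norm of a tangent vector in the Riemannian metric `g`. -/
def riemNorm (g : Metric n p M) {x : M} (v : TangentSpace (𝓡 n) x) : ℝ :=
  Real.sqrt (g.inner x v v)

/-- The Riemannian volume of the parallelepiped spanned by `n` tangent vectors at `x`:
the square root of their Gram determinant. -/
def riemVol (g : Metric n p M) {x : M} (v : Fin n → TangentSpace (𝓡 n) x) : ℝ :=
  Real.sqrt (Matrix.det (Matrix.of fun i j => g.inner x (v i) (v j)))

/-- The standard basis of the model space, as a frame of the tangent space at `x`. -/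
def stdFrame (x : M) (i : Fin n) : TangentSpace (𝓡 n) x :=
  (EuclideanSpace.single i (1 : ℝ) : EuclideanSpace ℝ (Fin n))

/-- `|det A|` for a linear map `A : T_x M → T_y M`, with respect to the Riemannian volumes on the
two tangent spaces: the factor by which `A` multiplies the volume of a parallelepiped (the quotient
does not depend on the frame used). -/
def absDet (g : Metric n p M) {x y : M}
    (A : TangentSpace (𝓡 n) x →L[ℝ] TangentSpace (𝓡 n) y) : ℝ :=
  riemVol g (fun i => A (stdFrame x i)) / riemVol g (stdFrame x)

/-- The differential `D_x φ^t : T_x M → T_{φ^t(x)} M` of the time-`t` map. -/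
abbrev flowDeriv (φ : ℝ → M → M) (t : ℝ) (x : M) :
    TangentSpace (𝓡 n) x →L[ℝ] TangentSpace (𝓡 n) (φ t x) :=
  mfderiv (𝓡 n) (𝓡 n) (φ t) x

/-- The forward Lyapunov exponent
`λ⁺(x, v) = limsup_{t → ∞} (1 / t) log ‖D_x φ^t v‖`, with `log 0 = -∞`. -/
def forwardExponent (g : Metric n p M) (φ : ℝ → M → M) (x : M) (v : TangentSpace (𝓡 n) x) :
    EReal :=
  limsup (fun t : ℝ => ((t⁻¹ : ℝ) : EReal) *
    ENNReal.log (ENNReal.ofReal (riemNorm g (flowDeriv φ t x v)))) atTop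

/-- The (Oseledets) splitting of `T_x M` and the distinct Lyapunov exponents
`χ₁ < ⋯ < χ_k` at a point `x`. The point `x` is Lyapunov regular for `φ` if and only if such a
splitting exists; the splitting is then unique. The limits of `(1 / t) log |det D_x φ^t|` are part of
Lyapunov regularity; they force the angles between the subspaces of the splitting to be
subexponential along the orbit. -/
structure LyapunovSplitting (g : Metric n p M) (φ : ℝ → M → M) (x : M) where
  /-- The number of distinct exponents. -/
  k : ℕ
  /-- The distinct exponents. -/
  χ : Fin k → ℝ
  χ_strictMono : StrictMono χ
  /-- The subspaces of the splitting. -/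
  E : Fin k → Submodule ℝ (TangentSpace (𝓡 n) x)
  E_ne_bot : ∀ i, E i ≠ ⊥
  isInternal : DirectSum.IsInternal E
  tendsto_atTop : ∀ i, ∀ v ∈ E i, v ≠ 0 →
    Tendsto (fun t : ℝ => t⁻¹ * Real.log (riemNorm g (flowDeriv φ t x v))) atTop (𝓝 (χ i))
  tendsto_atBot : ∀ i, ∀ v ∈ E i, v ≠ 0 →
    Tendsto (fun t : ℝ => t⁻¹ * Real.log (riemNorm g (flowDeriv φ t x v))) atBot (𝓝 (χ i))
  det_atTop : Tendsto (fun t : ℝ => t⁻¹ * Real.log (absDet g (flowDeriv φ t x))) atTop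
    (𝓝 (∑ i, (Module.finrank ℝ (E i) : ℝ) * χ i))
  det_atBot : Tendsto (fun t : ℝ => t⁻¹ * Real.log (absDet g (flowDeriv φ t x))) atBot
    (𝓝 (∑ i, (Module.finrank ℝ (E i) : ℝ) * χ i))

namespace LyapunovSplitting

variable {g : Metric n p M} {φ : ℝ → M → M} {x : M}

/-- The exponents in increasing order, each one repeated according to its multiplicity
`dim E i`. -/
def exponentList (S : LyapunovSplitting g φ x) : List ℝ :=
  (List.finRange S.k).flatMap fun i => List.replicate (Module.finrank ℝ (S.E i)) (S.χ i)

theorem length_exponentList (S : LyapunovSplitting g φ x) : S.exponentList.length = n := by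
  have h1 : FiniteDimensional ℝ (TangentSpace (𝓡 n) x) :=
    inferInstanceAs (FiniteDimensional ℝ (EuclideanSpace ℝ (Fin n)))
  have h2 : Module.finrank ℝ (TangentSpace (𝓡 n) x) = n :=
    finrank_euclideanSpace_fin (𝕜 := ℝ) (n := n)
  have h3 := (LinearEquiv.ofBijective (DirectSum.coeLinearMap S.E) S.isInternal).finrank_eq
  rw [Module.finrank_directSum, h2] at h3
  refine Eq.trans ?_ h3
  rw [exponentList, List.length_flatMap, ← List.sum_ofFn]
  simp [List.ofFn_eq_map]

/-- The Lyapunov exponents `λ₁ ≤ ⋯ ≤ λ_n` at `x`, counted with multiplicity. -/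
def exponent (S : LyapunovSplitting g φ x) (i : Fin n) : ℝ :=
  S.exponentList.get (i.cast S.length_exponentList.symm)

end LyapunovSplitting

/-- The regular set `{x | f x ≠ 0}` of the vector field `f`. -/
def regularSet (f : ∀ x : M, TangentSpace (𝓡 n) x) : Set M :=
  {x | f x ≠ 0}

/-- A Lyapunov regular point `x`, with splitting `S`, belongs to the set `𝓡` if `f x ≠ 0` and the
Lyapunov exponent in the direction of `f x` is one of multiplicity one. -/
def HasSimpleFlowExponent {g : Metric n p M} {φ : ℝ → M → M} {x : M}
    (f : ∀ x : M, TangentSpace (𝓡 n) x) (S : LyapunovSplitting g φ x) : Prop :=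
  x ∈ regularSet f ∧
    ∃ j : Fin S.k, Module.finrank ℝ (S.E j) = 1 ∧ forwardExponent g φ x (f x) = (S.χ j : EReal)

/-- `f` is a vector field of class `C^ℓ`. -/
def IsCkVectorField (ℓ : WithTop ℕ∞) (f : ∀ x : M, TangentSpace (𝓡 n) x) : Prop :=
  ContMDiff (𝓡 n) (𝓡 n).tangent ℓ (fun x => (⟨x, f x⟩ : TangentBundle (𝓡 n) M))

/-- `φ` is a (complete) flow of class `C^ℓ` on the subset `U` of `M`. Values outside `U` are
irrelevant. -/
structure IsCkFlowOn (ℓ : WithTop ℕ∞) (φ : ℝ → M → M) (U : Set M) : Prop where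
  mapsTo : ∀ t, MapsTo (φ t) U U
  zero : ∀ x ∈ U, φ 0 x = x
  add : ∀ s t, ∀ x ∈ U, φ (s + t) x = φ s (φ t x)
  contMDiffOn : ContMDiffOn (𝓘(ℝ, ℝ).prod (𝓡 n)) (𝓡 n) ℓ (fun q : ℝ × M => φ q.1 q.2)
    (univ ×ˢ U)

/-- The flow `ψ` is a time reparameterization of the flow `φ` on the set `U` of non-fixed points:
the orbits and their orientations coincide, and `ψ^τ(x) = φ^{t(x,τ)}(x)`. The function `r`,
`r(x) = (∂t/∂τ (x,0))⁻¹ > 0`, is the one with `dτ = r dt`. -/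
structure IsTimeReparametrization (ℓ : WithTop ℕ∞) (φ ψ : ℝ → M → M) (t : M → ℝ → ℝ) (r : M → ℝ)
    (U : Set M) : Prop where
  isCkFlowOn : IsCkFlowOn (n := n) ℓ ψ U
  orbit_eq : ∀ x ∈ U, range (fun τ => ψ τ x) = range (fun s => φ s x)
  eq_flow : ∀ x ∈ U, ∀ τ, ψ τ x = φ (t x τ) x
  strictMono : ∀ x ∈ U, StrictMono (t x)
  cocycle : ∀ x ∈ U, ∀ τ₁ τ₂, t x (τ₁ + τ₂) = t x τ₁ + t (ψ τ₁ x) τ₂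
  contMDiffOn : ContMDiffOn ((𝓡 n).prod 𝓘(ℝ, ℝ)) 𝓘(ℝ, ℝ) ℓ (fun q : M × ℝ => t q.1 q.2)
    (U ×ˢ univ)
  r_pos : ∀ x ∈ U, 0 < r x
  hasDerivAt : ∀ x ∈ U, HasDerivAt (t x) (r x)⁻¹ 0

/-- `a` is the forward time average `r₊(x) = lim_{T → ∞} (1 / T) ∫₀ᵀ r(φ^s(x)) ds`. -/
def IsForwardAverage (φ : ℝ → M → M) (r : M → ℝ) (x : M) (a : ℝ) : Prop :=
  Tendsto (fun T : ℝ => T⁻¹ * ∫ s in (0 : ℝ)..T, r (φ s x)) atTop (𝓝 a)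

end TimeChange

end

/-! Since ψ^τ(y) = φ^{t(y,τ)}(y), the chain rule gives Dψ^τ v = Dφ^{t(x,τ)}(v + s f(x)) with a
scalar s depending on v and τ (`exists_flowEnd_eq`, `flowEnd_fieldVec`): up to a shear along the
flow direction, only time is rescaled. As dτ = r dt, τ is the integral of r over [0, t(x,τ)], so
t(x,τ)/τ → 1/r₊ (`tendsto_inv_mul_of_average`), and Φ observed in the time τ has exponents λᵢ/r₊.

No bound on the shear s is available; Lyapunov regularity replaces it through volumes. In a basis
whose volume grows at the sum of the exponents of its vectors, Hadamard's inequality forces every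
vector with a fixed nonzero i-th coordinate, even one varying with time, to grow at least at the
i-th rate (`growthGE_of_repr`). Both flows have such bases, and both bases can be made to contain
f(x) (`exists_mem`). For every a, the span of f(x) and of the basis vectors with exponent at most a
is then the same for both flows (`span_le`). If f(x) also has the same exponent for both, the
numbers of exponents at most a agree (`card_eq`), and these numbers determine the sorted lists.

In the flow direction the two norms differ by the factor r(x) ∂t/∂τ. Different rates would drive
∂t/∂τ to ∞ or to 0, against the positive limit of t/τ (`growth_rate_eq`). -/

noncomputable section

namespace TimeChange

/-! ### Exponential growth rates -/

/-- The exponential growth rate of `u` at `+∞` is at most `c`. -/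
def GrowthLE (u : ℝ → ℝ) (c : ℝ) : Prop :=
  ∀ ε > 0, ∀ᶠ t in atTop, u t ≤ Real.exp ((c + ε) * t)

/-- The lower exponential growth rate of `u` at `+∞` is at least `c`. -/
def GrowthGE (u : ℝ → ℝ) (c : ℝ) : Prop :=
  ∀ ε > 0, ∀ᶠ t in atTop, Real.exp ((c - ε) * t) ≤ u t

theorem GrowthLE.mono {u : ℝ → ℝ} {c d : ℝ} (hu : GrowthLE u c) (hcd : c ≤ d) :
    GrowthLE u d := by
  intro ε hε
  filter_upwards [hu ε hε, eventually_ge_atTop 0] with t ht ht0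
  exact ht.trans (Real.exp_le_exp.2 (by gcongr))

theorem GrowthGE.mono_fun {u v : ℝ → ℝ} {c : ℝ} (hu : GrowthGE u c) (huv : ∀ t, u t ≤ v t) :
    GrowthGE v c := by
  intro ε hε
  filter_upwards [hu ε hε] with t ht
  exact ht.trans (huv t)

theorem growthLE_const (C : ℝ) : GrowthLE (fun _ => C) 0 := by
  intro ε hε
  have h : Tendsto (fun t : ℝ => Real.exp ((0 + ε) * t)) atTop atTop :=
    Real.tendsto_exp_atTop.comp (tendsto_id.const_mul_atTop (by simpa using hε))
  exact h.eventually_ge_atTop C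

theorem GrowthLE.mul {u v : ℝ → ℝ} {c d : ℝ} (hu : GrowthLE u c) (hv : GrowthLE v d)
    (hv0 : ∀ t, 0 ≤ v t) : GrowthLE (fun t => u t * v t) (c + d) := by
  intro ε hε
  filter_upwards [hu (ε / 2) (by positivity), hv (ε / 2) (by positivity)] with t h1 h2
  calc u t * v t ≤ Real.exp ((c + ε / 2) * t) * Real.exp ((d + ε / 2) * t) :=
        mul_le_mul h1 h2 (hv0 t) (Real.exp_pos _).le
    _ = _ := by rw [← Real.exp_add]; congr 1; ring

theorem GrowthLE.add {u v : ℝ → ℝ} {c : ℝ} (hu : GrowthLE u c) (hv : GrowthLE v c) :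
    GrowthLE (fun t => u t + v t) c := by
  intro ε hε
  filter_upwards [hu (ε / 2) (by positivity), hv (ε / 2) (by positivity),
    growthLE_const 2 (ε / 2) (by positivity)] with t h1 h2 h3
  calc u t + v t ≤ Real.exp ((0 + ε / 2) * t) * Real.exp ((c + ε / 2) * t) := by
        nlinarith [Real.exp_pos ((c + ε / 2) * t)]
    _ = _ := by rw [← Real.exp_add]; congr 1; ring

theorem GrowthLE.finset_prod {ι : Type*} (s : Finset ι) {u : ι → ℝ → ℝ} {c : ι → ℝ}
    (hu : ∀ i ∈ s, GrowthLE (u i) (c i)) (hu0 : ∀ i t, 0 ≤ u i t) :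
    GrowthLE (fun t => ∏ i ∈ s, u i t) (∑ i ∈ s, c i) := by
  classical
  induction s using Finset.induction_on with
  | empty => simpa using growthLE_const 1
  | insert a s ha ih =>
    simp only [Finset.prod_insert ha, Finset.sum_insert ha]
    exact (hu a (by simp)).mul (ih fun i hi => hu i (by simp [hi]))
      fun t => Finset.prod_nonneg fun i _ => hu0 i t

/-- The division is by the exponential that dominates `v`, not by `v`, so `v` may vanish. -/
theorem GrowthGE.of_mul {u v : ℝ → ℝ} {c d : ℝ} (huv : GrowthGE (fun t => u t * v t) c)
    (hv : GrowthLE v d) (hu0 : ∀ t, 0 ≤ u t) : GrowthGE u (c - d) := by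
  intro ε hε
  filter_upwards [huv (ε / 2) (by positivity), hv (ε / 2) (by positivity)] with t h1 h2
  have h3 : Real.exp ((c - d - ε) * t) * Real.exp ((d + ε / 2) * t)
      ≤ u t * Real.exp ((d + ε / 2) * t) := by
    rw [← Real.exp_add]
    refine le_trans (le_of_eq ?_) (h1.trans (mul_le_mul_of_nonneg_left h2 (hu0 t)))
    congr 1; ring
  exact le_of_mul_le_mul_right h3 (Real.exp_pos _)

theorem GrowthGE.le {u : ℝ → ℝ} {c d : ℝ} (hc : GrowthGE u c) (hd : GrowthLE u d) : c ≤ d := by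
  refine le_of_forall_pos_le_add fun ε hε => ?_
  obtain ⟨t, h1, h2, h3⟩ := ((hc (ε / 2) (by positivity)).and
    ((hd (ε / 2) (by positivity)).and (eventually_gt_atTop 0))).exists
  have h4 := le_of_mul_le_mul_right (Real.exp_le_exp.1 (h1.trans h2)) h3
  linarith

theorem growthLE_of_tendsto {u : ℝ → ℝ} {c : ℝ} (hu : ∀ t, 0 < u t)
    (h : Tendsto (fun t : ℝ => t⁻¹ * Real.log (u t)) atTop (𝓝 c)) : GrowthLE u c := by
  intro ε hε
  filter_upwards [h.eventually_lt_const (show c < c + ε by linarith), eventually_gt_atTop 0]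
    with t h1 h2
  rw [← Real.log_le_iff_le_exp (hu t)]
  rw [inv_mul_lt_iff₀ h2] at h1
  linarith [mul_comm t (c + ε)]

theorem growthGE_of_tendsto {u : ℝ → ℝ} {c : ℝ} (hu : ∀ t, 0 < u t)
    (h : Tendsto (fun t : ℝ => t⁻¹ * Real.log (u t)) atTop (𝓝 c)) : GrowthGE u c := by
  intro ε hε
  filter_upwards [h.eventually_const_lt (show c - ε < c by linarith), eventually_gt_atTop 0]
    with t h1 h2
  rw [← Real.le_log_iff_exp_le (hu t)]
  rw [lt_inv_mul_iff₀ h2] at h1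
  linarith [mul_comm t (c - ε)]

/-! ### Gram determinants -/

section Gram

variable {ι V : Type*} [Fintype ι] [DecidableEq ι] [AddCommGroup V] [Module ℝ V]

/-- The Gram determinant of the vectors `v i` with respect to the bilinear form `B`. -/
def gramDet (B : V →ₗ[ℝ] V →ₗ[ℝ] ℝ) (v : ι → V) : ℝ :=
  Matrix.det (Matrix.of fun i j => B (v i) (v j))

theorem gramDet_eq_det_sq_mul (B : V →ₗ[ℝ] V →ₗ[ℝ] ℝ) (b : Module.Basis ι ℝ V) (v : ι → V) :
    gramDet B v = b.det v ^ 2 * gramDet B b := by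
  have h : (Matrix.of fun i j => B (v i) (v j)) =
      (b.toMatrix v).transpose * (Matrix.of fun i j => B (b i) (b j)) * b.toMatrix v := by
    ext i j
    conv_lhs => rw [Matrix.of_apply, ← b.sum_repr (v i), ← b.sum_repr (v j)]
    simp only [map_sum, LinearMap.sum_apply, map_smul, LinearMap.smul_apply, smul_eq_mul,
      Matrix.mul_apply, Matrix.transpose_apply, Module.Basis.toMatrix_apply, Matrix.of_apply,
      Finset.sum_mul, Finset.mul_sum]
    exact Finset.sum_congr rfl fun k _ => Finset.sum_congr rfl fun l _ => by ring
  rw [gramDet, h, Matrix.det_mul, Matrix.det_mul, Matrix.det_transpose, Module.Basis.det_apply,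
    gramDet]
  ring

/-- Cramer's rule for the identity matrix. Hence exchanging one basis vector for `w` scales the
volume by a coordinate of `w`. -/
theorem det_update_self (b : Module.Basis ι ℝ V) (i : ι) (w : V) :
    b.det (Function.update b i w) = b.repr w i := by
  rw [Module.Basis.det_apply, Module.Basis.toMatrix_update, Module.Basis.toMatrix_self,
    ← Matrix.cramer_apply, Matrix.cramer_one]
  rfl

/-- A weak form of Hadamard's inequality. -/
theorem gramDet_le {B : V →ₗ[ℝ] V →ₗ[ℝ] ℝ} (hB : ∀ v w, B v w = B w v) (hB0 : ∀ v, 0 ≤ B v v)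
    (v : ι → V) : gramDet B v ≤ ((Fintype.card ι).factorial : ℝ) * ∏ i, B (v i) (v i) := by
  have hCS : ∀ x y, |B x y| ≤ Real.sqrt (B x x) * Real.sqrt (B y y) := by
    intro x y
    rw [← Real.sqrt_mul (hB0 x)]
    refine Real.abs_le_sqrt ?_
    exact LinearMap.BilinForm.apply_sq_le_of_symm B hB0 ⟨fun a b => by simp [hB a b]⟩ x y
  -- By Cauchy–Schwarz each Leibniz term is at most the product of the squared norms, because a
  -- permutation only reorders the factors. The factorial counts the terms; as a constant it does
  -- not affect growth rates.
  have hterm : ∀ σ : Equiv.Perm ι,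
      (Equiv.Perm.sign σ : ℝ) * ∏ i, B (v (σ i)) (v i) ≤ ∏ i, B (v i) (v i) := by
    intro σ
    have h1 : |(Equiv.Perm.sign σ : ℝ)| = 1 := by
      rcases Int.units_eq_one_or (Equiv.Perm.sign σ) with h | h <;> simp [h]
    calc (Equiv.Perm.sign σ : ℝ) * ∏ i, B (v (σ i)) (v i)
        ≤ |(Equiv.Perm.sign σ : ℝ) * ∏ i, B (v (σ i)) (v i)| := le_abs_self _
      _ = ∏ i, |B (v (σ i)) (v i)| := by rw [abs_mul, h1, one_mul, Finset.abs_prod]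
      _ ≤ ∏ i, (Real.sqrt (B (v (σ i)) (v (σ i))) * Real.sqrt (B (v i) (v i))) :=
        Finset.prod_le_prod (fun i _ => abs_nonneg _) fun i _ => hCS _ _
      _ = ∏ i, B (v i) (v i) := by
        rw [Finset.prod_mul_distrib, Equiv.prod_comp σ fun i => Real.sqrt (B (v i) (v i)),
          ← Finset.prod_mul_distrib]
        exact Finset.prod_congr rfl fun i _ => Real.mul_self_sqrt (hB0 _)
  rw [gramDet, Matrix.det_apply']
  calc _ ≤ ∑ _σ : Equiv.Perm ι, ∏ i, B (v i) (v i) := Finset.sum_le_sum fun σ _ => hterm σ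
    _ = _ := by simp [Fintype.card_perm]

theorem gramDet_pos {B : V →ₗ[ℝ] V →ₗ[ℝ] ℝ} (hB : ∀ v w, B v w = B w v)
    (hB0 : ∀ v, v ≠ 0 → 0 < B v v) (b : Module.Basis ι ℝ V) : 0 < gramDet B b := by
  refine Matrix.PosDef.det_pos ?_
  refine Matrix.PosDef.of_dotProduct_mulVec_pos ?_ fun x hx => ?_
  · ext i j
    simp [Matrix.conjTranspose_apply, hB (b i) (b j)]
  · have h : star x ⬝ᵥ (Matrix.of fun i j => B (b i) (b j)).mulVec x =
        B (∑ i, x i • b i) (∑ i, x i • b i) := by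
      simp only [map_sum, LinearMap.sum_apply, map_smul, LinearMap.smul_apply, smul_eq_mul,
        dotProduct, Matrix.mulVec, Matrix.of_apply, Finset.mul_sum, star_trivial]
      rw [Finset.sum_comm]
      exact Finset.sum_congr rfl fun k _ => Finset.sum_congr rfl fun l _ => by ring
    rw [h]
    refine hB0 _ fun h0 => hx ?_
    ext i
    exact Fintype.linearIndependent_iff.1 b.linearIndependent x h0 i

end Gram

/-! ### Regular bases of a family of bilinear forms -/

theorem finrank_span_image {ι V : Type*} [AddCommGroup V] [Module ℝ V]
    (b : Module.Basis ι ℝ V) (s : Finset ι) :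
    Module.finrank ℝ (Submodule.span ℝ (b '' (s : Set ι))) = s.card := by
  classical
  rw [← Finset.coe_image, finrank_span_finset_eq_card,
    Finset.card_image_of_injective _ b.injective]
  rw [Finset.coe_image]
  exact (b.linearIndependent.linearIndepOn (s := (s : Set ι))).id_image

section Regular

variable {ι V : Type*} [Fintype ι] [DecidableEq ι] [AddCommGroup V] [Module ℝ V]

/-- The basis `b` has exponents at most `e` for the family `B t` of bilinear forms, and the volume
of the parallelepiped it spans grows at the rate `∑ i, e i`. -/
structure IsRegularBasis (B : ℝ → V →ₗ[ℝ] V →ₗ[ℝ] ℝ) (b : Module.Basis ι ℝ V) (e : ι → ℝ) :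
    Prop where
  symm : ∀ t v w, B t v w = B t w v
  nonneg : ∀ t v, 0 ≤ B t v v
  growthLE : ∀ i, GrowthLE (fun t => Real.sqrt (B t (b i) (b i))) (e i)
  growthGE : GrowthGE (fun t => Real.sqrt (gramDet (B t) b)) (∑ i, e i)

namespace IsRegularBasis

variable {B : ℝ → V →ₗ[ℝ] V →ₗ[ℝ] ℝ} {b : Module.Basis ι ℝ V} {e : ι → ℝ}

/-- Replacing `b i` by `w` multiplies the volume by |b.repr w i|, and Hadamard's inequality bounds
the new volume by the product of the norms. -/
theorem sqrt_gramDet_le (h : IsRegularBasis B b e) {i : ι} {w : V} (hw : b.repr w i ≠ 0) (t : ℝ) :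
    Real.sqrt (gramDet (B t) b) ≤ Real.sqrt (B t w w) *
      (|b.repr w i|⁻¹ * Real.sqrt (Fintype.card ι).factorial *
        ∏ k ∈ Finset.univ.erase i, Real.sqrt (B t (b k) (b k))) := by
  have h1 := gramDet_le (h.symm t) (h.nonneg t) (Function.update b i w)
  rw [gramDet_eq_det_sq_mul _ b, det_update_self] at h1
  have h2 := Real.sqrt_le_sqrt h1
  rw [Real.sqrt_mul (sq_nonneg _), Real.sqrt_sq_eq_abs, Real.sqrt_mul (by positivity),
    Real.sqrt_prod _ fun k _ => h.nonneg t _,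
    ← Finset.mul_prod_erase _ _ (Finset.mem_univ i)] at h2
  have h3 : ∏ k ∈ Finset.univ.erase i,
      Real.sqrt (B t (Function.update b i w k) (Function.update b i w k)) =
      ∏ k ∈ Finset.univ.erase i, Real.sqrt (B t (b k) (b k)) :=
    Finset.prod_congr rfl fun k hk => by rw [Function.update_of_ne (Finset.ne_of_mem_erase hk)]
  rw [h3, Function.update_self] at h2
  rw [← mul_le_mul_iff_right₀ (abs_pos.2 hw)]
  refine h2.trans (le_of_eq ?_)
  field_simp [abs_pos.2 hw]

/-- The volume grows at the full sum of the exponents and the other basis vectors account for at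
most the sum without `e i`, so `w t` must supply the rest. Only the i-th coordinate of `w t` enters;
this freedom absorbs time-dependent multiples of the flow direction. -/
theorem growthGE_of_repr (h : IsRegularBasis B b e) {i : ι} {w : ℝ → V} {c : ℝ} (hc : c ≠ 0)
    (hw : ∀ t, b.repr (w t) i = c) :
    GrowthGE (fun t => Real.sqrt (B t (w t) (w t))) (e i) := by
  have h1 : GrowthLE (fun t => |c|⁻¹ * Real.sqrt (Fintype.card ι).factorial *
        ∏ k ∈ Finset.univ.erase i, Real.sqrt (B t (b k) (b k)))
      (0 + ∑ k ∈ Finset.univ.erase i, e k) :=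
    (growthLE_const _).mul (GrowthLE.finset_prod _ (fun k _ => h.growthLE k)
      fun _ _ => Real.sqrt_nonneg _) fun t => Finset.prod_nonneg fun _ _ => Real.sqrt_nonneg _
  have h2 := GrowthGE.of_mul (h.growthGE.mono_fun fun t => by
    have := h.sqrt_gramDet_le (i := i) (w := w t) (by rwa [hw]) t
    rwa [hw] at this) h1 fun t => Real.sqrt_nonneg _
  have h3 : ∑ k, e k - (0 + ∑ k ∈ Finset.univ.erase i, e k) = e i := by
    rw [← Finset.add_sum_erase _ _ (Finset.mem_univ i)]; ring
  rwa [h3] at h2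

/-- A vector whose coordinates at exponents exceeding `a` vanish grows at rate at most `a`. -/
theorem growthLE_of_repr (h : IsRegularBasis B b e) {w : V} {a : ℝ}
    (hw : ∀ i, b.repr w i ≠ 0 → e i ≤ a) :
    GrowthLE (fun t => Real.sqrt (B t w w)) a := by
  have tri : ∀ t v w, Real.sqrt (B t (v + w) (v + w)) ≤
      Real.sqrt (B t v v) + Real.sqrt (B t w w) := by
    intro t v w
    refine Real.sqrt_le_iff.2 ⟨by positivity, ?_⟩
    have hCS : B t v w ≤ Real.sqrt (B t v v) * Real.sqrt (B t w w) := by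
      rw [← Real.sqrt_mul (h.nonneg t v)]
      exact (le_abs_self _).trans (Real.abs_le_sqrt
        (LinearMap.BilinForm.apply_sq_le_of_symm (B t) (h.nonneg t)
          ⟨fun a b => by simp [h.symm t a b]⟩ v w))
    have e1 : B t (v + w) (v + w) = B t v v + 2 * B t v w + B t w w := by
      simp only [map_add, LinearMap.add_apply]
      rw [h.symm t w v]; ring
    rw [e1, add_sq, Real.sq_sqrt (h.nonneg t v), Real.sq_sqrt (h.nonneg t w)]
    linarith
  have key : ∀ s : Finset ι, GrowthLE (fun t => Real.sqrt (B t (∑ i ∈ s, b.repr w i • b i)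
      (∑ i ∈ s, b.repr w i • b i))) a := by
    intro s
    induction s using Finset.induction_on with
    | empty =>
      intro ε _
      filter_upwards with t
      simpa using (Real.exp_pos _).le
    | insert k s hk ih =>
      rw [Finset.sum_insert hk]
      intro ε hε
      have h1 : GrowthLE (fun t => Real.sqrt (B t (b.repr w k • b k) (b.repr w k • b k))) a := by
        by_cases h0 : b.repr w k = 0
        · intro ε _
          filter_upwards with t
          simpa [h0] using (Real.exp_pos _).le
        · have h2 := ((growthLE_const |b.repr w k|).mul (h.growthLE k)
            fun t => Real.sqrt_nonneg _).mono (by simpa using hw k h0)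
          convert h2 using 2 with t
          rw [map_smul, map_smul, LinearMap.smul_apply, smul_smul, smul_eq_mul,
            Real.sqrt_mul (mul_self_nonneg _), Real.sqrt_mul_self_eq_abs]
      filter_upwards [(h1.add ih) ε hε] with t ht
      exact (tri t _ _).trans ht
  have := key Finset.univ
  rwa [b.sum_repr] at this

/-- A nonzero vector can be made part of a regular basis with the same exponents. -/
theorem exists_mem (h : IsRegularBasis B b e) {f : V} (hf : f ≠ 0) :
    ∃ (b' : Module.Basis ι ℝ V) (i : ι), IsRegularBasis B b' e ∧ b' i = f := by
  have hne : (Finset.univ.filter fun i => b.repr f i ≠ 0).Nonempty := by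
    by_contra hcon
    rw [Finset.not_nonempty_iff_eq_empty, Finset.filter_eq_empty_iff] at hcon
    refine hf (b.repr.map_eq_zero_iff.1 (Finsupp.ext fun i => ?_))
    simpa using hcon (Finset.mem_univ i)
  -- The index of largest exponent among those present in `f`: then `f` grows at rate at most `e i`
  -- and can take the place of `b i`, while the volume changes only by a constant factor.
  obtain ⟨i, hi, hmax⟩ := Finset.exists_max_image _ e hne
  have hi0 : b.repr f i ≠ 0 := (Finset.mem_filter.1 hi).2
  have hdet : IsUnit (b.det (Function.update b i f)) := by
    rw [det_update_self]; exact hi0.isUnit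
  obtain ⟨hli, hspan⟩ := b.is_basis_iff_det.2 hdet
  let b' := Module.Basis.mk hli hspan.ge
  have hb' : (b' : ι → V) = Function.update b i f := Module.Basis.coe_mk _ _
  refine ⟨b', i, ⟨h.symm, h.nonneg, fun k => ?_, ?_⟩, by rw [hb', Function.update_self]⟩
  · rw [hb']
    rcases eq_or_ne k i with rfl | hk
    · rw [Function.update_self]
      exact h.growthLE_of_repr fun j hj => hmax j (by simpa using hj)
    · rw [Function.update_of_ne hk]
      exact h.growthLE k
  · have h1 : ∀ t, Real.sqrt (gramDet (B t) b') =
        |b.repr f i| * Real.sqrt (gramDet (B t) b) := by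
      intro t
      rw [hb', gramDet_eq_det_sq_mul _ b, det_update_self, Real.sqrt_mul (sq_nonneg _),
        Real.sqrt_sq_eq_abs]
    have h2 := GrowthGE.of_mul (u := fun t => Real.sqrt (gramDet (B t) b'))
      (v := fun _ => |b.repr f i|⁻¹) (c := ∑ i, e i) (d := 0)
      (h.growthGE.mono_fun fun t => le_of_eq (by
        have := abs_pos.2 hi0
        rw [h1]; field_simp))
      (growthLE_const _) fun t => Real.sqrt_nonneg _
    simpa using h2

theorem growthGE_basis (h : IsRegularBasis B b e) (i : ι) :
    GrowthGE (fun t => Real.sqrt (B t (b i) (b i))) (e i) :=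
  h.growthGE_of_repr (w := fun _ => b i) one_ne_zero (by simp)

/-- A vector that grows at rate at most `a` modulo a basis vector `b i` lies in the span of `b i`
and of the basis vectors of exponent at most `a`. -/
theorem mem_span (h : IsRegularBasis B b e) {i : ι} {v : V} {s : ℝ → ℝ} {a : ℝ}
    (hv : GrowthLE (fun t => Real.sqrt (B t (v + s t • b i) (v + s t • b i))) a) :
    v ∈ Submodule.span ℝ (b '' {k | k = i ∨ e k ≤ a}) := by
  rw [b.mem_span_image]
  intro k hk
  by_contra hcon
  simp only [Set.mem_ofPred_eq, not_or, not_le] at hcon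
  -- Adding multiples of `b i` leaves the coordinate at `k ≠ i` constant, so a nonzero one forces
  -- growth at least `e k > a`.
  have := (h.growthGE_of_repr (i := k) (w := fun t => v + s t • b i)
    (Finsupp.mem_support_iff.1 hk) fun t => by
      simp [Ne.symm hcon.1]).le hv
  linarith

/-- A vector `b k` of exponent at most `a` for `B` has the same growth for `B'` after a
time-dependent correction along `b' j`, so `mem_span` applies. Including the common vector whatever
its exponent makes the span insensitive to the correction. -/
theorem span_le {κ : Type*} [Fintype κ] [DecidableEq κ] {B' : ℝ → V →ₗ[ℝ] V →ₗ[ℝ] ℝ}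
    {b' : Module.Basis κ ℝ V} {e' : κ → ℝ} (h : IsRegularBasis B b e)
    (h' : IsRegularBasis B' b' e') {i : ι} {j : κ} (hij : b i = b' j)
    (hBB' : ∀ t v, ∃ s : ℝ, B' t (v + s • b' j) (v + s • b' j) = B t v v) (a : ℝ) :
    Submodule.span ℝ (b '' {k | k = i ∨ e k ≤ a}) ≤
      Submodule.span ℝ (b' '' {k | k = j ∨ e' k ≤ a}) := by
  rw [Submodule.span_le]
  rintro _ ⟨k, rfl | hk, rfl⟩
  · rw [hij]
    exact Submodule.subset_span ⟨j, Or.inl rfl, rfl⟩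
  · choose s hs using fun t => hBB' t (b k)
    refine h'.mem_span (s := s) ?_
    simp only [hs]
    exact (h.growthLE k).mono hk

/-- Regular bases of two families of forms that agree modulo a common basis vector of the same
exponent have the same exponents, counted with multiplicity. -/
theorem card_eq {κ : Type*} [Fintype κ] [DecidableEq κ] {B' : ℝ → V →ₗ[ℝ] V →ₗ[ℝ] ℝ}
    {b' : Module.Basis κ ℝ V} {e' : κ → ℝ} (h : IsRegularBasis B b e)
    (h' : IsRegularBasis B' b' e') {i : ι} {j : κ} (hij : b i = b' j) (he : e i = e' j)
    (hBB' : ∀ t v, ∃ s : ℝ, B' t (v + s • b' j) (v + s • b' j) = B t v v)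
    (hB'B : ∀ t v, ∃ s : ℝ, B t (v + s • b i) (v + s • b i) = B' t v v) (a : ℝ) :
    (Finset.univ.filter fun k => e k ≤ a).card = (Finset.univ.filter fun k => e' k ≤ a).card := by
  have hspan := le_antisymm (h.span_le h' hij hBB' a) (h'.span_le h hij.symm hB'B a)
  have h1 : (Finset.univ.filter fun k => k = i ∨ e k ≤ a).card =
      (Finset.univ.filter fun k => k = j ∨ e' k ≤ a).card := by
    rw [← finrank_span_image b, ← finrank_span_image b']
    rw [Finset.coe_filter_univ, Finset.coe_filter_univ, hspan]
  rw [Finset.filter_or, Finset.filter_or, Finset.filter_eq', Finset.filter_eq',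
    if_pos (Finset.mem_univ _), if_pos (Finset.mem_univ _)] at h1
  -- The common vector was included by force; since `e i = e' j`, it has to be discounted on both
  -- sides or on neither.
  by_cases hia : e i ≤ a
  · rwa [Finset.union_eq_right.2 (by simpa using hia),
      Finset.union_eq_right.2 (by simpa [he] using hia)] at h1
  · rw [Finset.card_union_of_disjoint (by simpa using hia),
      Finset.card_union_of_disjoint (by simpa [← he] using hia)] at h1
    simpa using h1

end IsRegularBasis

end Regular

/-! ### Asymptotics of a change of time -/

theorem GrowthGE.tendsto_atTop {u : ℝ → ℝ} {c : ℝ} (hu : GrowthGE u c) (hc : 0 < c) :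
    Tendsto u atTop atTop := by
  have h : Tendsto (fun t : ℝ => Real.exp ((c - c / 2) * t)) atTop atTop :=
    Real.tendsto_exp_atTop.comp (tendsto_id.const_mul_atTop (by linarith))
  exact tendsto_atTop_mono' _ (hu (c / 2) (by positivity)) h

/-- By the mean value inequality `T` eventually lies above a line of slope `K`, whose intercept
disappears after division by τ. -/
theorem le_of_tendsto_of_le_deriv {T T' : ℝ → ℝ} {L K : ℝ} (hT : ∀ τ, HasDerivAt T (T' τ) τ)
    (hL : Tendsto (fun τ : ℝ => τ⁻¹ * T τ) atTop (𝓝 L)) (hK : ∀ᶠ τ in atTop, K ≤ T' τ) :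
    K ≤ L := by
  obtain ⟨a, ha⟩ := eventually_atTop.1 hK
  have h1 : ∀ τ ≥ a, T a + K * (τ - a) ≤ T τ := by
    intro τ hτ
    have := Convex.mul_sub_le_image_sub_of_le_deriv (convex_Ici a) (f := T) (C := K)
      (fun s _ => (hT s).continuousAt.continuousWithinAt)
      (fun s _ => (hT s).differentiableAt.differentiableWithinAt)
      (fun s hs => by rw [(hT s).deriv]; exact ha s (interior_subset hs))
      a self_mem_Ici τ hτ hτ
    linarith
  have h2 : Tendsto (fun τ : ℝ => τ⁻¹ * (T a - K * a) + K) atTop (𝓝 (0 * (T a - K * a) + K)) :=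
    (tendsto_inv_atTop_zero.mul_const _).add_const _
  rw [zero_mul, zero_add] at h2
  refine le_of_tendsto_of_tendsto h2 hL ?_
  filter_upwards [eventually_ge_atTop a, eventually_gt_atTop 0] with τ hτ h0
  have h3 := mul_le_mul_of_nonneg_left (h1 τ hτ) (inv_pos.2 h0).le
  refine le_trans (le_of_eq ?_) h3
  field_simp
  ring

/-- If `v = c T' u`, where `T τ / τ` has a positive limit, then `u` and `v` cannot have different
exponential growth rates. -/
theorem growth_rate_eq {T T' u v : ℝ → ℝ} {L c e e' : ℝ} (hT : ∀ τ, HasDerivAt T (T' τ) τ)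
    (hT' : ∀ τ, 0 < T' τ) (hL : Tendsto (fun τ : ℝ => τ⁻¹ * T τ) atTop (𝓝 L)) (hL0 : 0 < L)
    (hc : 0 < c) (huv : ∀ τ, v τ = c * T' τ * u τ) (hu : GrowthLE u e) (hu' : GrowthGE u e)
    (hv : GrowthLE v e') (hv' : GrowthGE v e') : e = e' := by
  rcases lt_trichotomy e e' with hlt | heq | hlt
  -- Here `T'` would grow exponentially and eventually exceed `L + 1`, contradicting the limit `L`
  -- of T τ / τ.
  · have h1 : GrowthGE (fun τ => c * T' τ) (e' - e) :=
      GrowthGE.of_mul (hv'.mono_fun fun τ => (huv τ).le) hu fun τ => (mul_pos hc (hT' τ)).le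
    have h2 := (h1.tendsto_atTop (by linarith)).eventually_ge_atTop (c * (L + 1))
    have := le_of_tendsto_of_le_deriv hT hL (K := L + 1) (by
      filter_upwards [h2] with τ hτ
      exact le_of_mul_le_mul_left hτ hc)
    linarith
  · exact heq
  -- Here `T'` would tend to 0 and eventually stay below `L / 2`; the mean value bound is applied to
  -- `-T`.
  · have h1 : GrowthGE (fun τ => (c * T' τ)⁻¹) (e - e') :=
      GrowthGE.of_mul (v := v) (hu'.mono_fun fun τ => by
        have := hT' τ
        rw [huv]; apply le_of_eq; field_simp) hv fun τ => (inv_pos.2 (mul_pos hc (hT' τ))).le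
    have h2 := (h1.tendsto_atTop (by linarith)).eventually_ge_atTop ((c * (L / 2))⁻¹)
    have := le_of_tendsto_of_le_deriv (T := fun τ => - T τ) (T' := fun τ => - T' τ) (L := - L)
      (fun τ => (hT τ).neg) (by simpa using hL.neg) (K := - (L / 2)) (by
      filter_upwards [h2] with τ hτ
      rw [inv_le_inv₀ (by positivity) (mul_pos hc (hT' τ))] at hτ
      linarith [le_of_mul_le_mul_left hτ hc])
    linarith

/-- The substitution s = T σ turns the integrand into R(T σ) · (R(T σ))⁻¹ = 1. -/
theorem integral_comp_inv_deriv {T R : ℝ → ℝ} (hmono : StrictMono T) (h0 : T 0 = 0)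
    (hT : ∀ τ, HasDerivAt T (R (T τ))⁻¹ τ) (hR0 : ∀ s, 0 < R s) {τ : ℝ} (hτ : 0 ≤ τ) :
    ∫ s in (0 : ℝ)..T τ, R s = τ := by
  have hcont : Continuous T := continuous_iff_continuousAt.2 fun τ => (hT τ).continuousAt
  have himg : T '' Icc 0 τ = Icc 0 (T τ) := by
    refine Subset.antisymm ?_ ?_
    · rintro _ ⟨s, hs, rfl⟩
      exact ⟨h0 ▸ hmono.monotone hs.1, hmono.monotone hs.2⟩
    · have := intermediate_value_Icc hτ hcont.continuousOn
      rwa [h0] at this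
  rw [intervalIntegral.integral_of_le (h0 ▸ hmono.monotone hτ),
    ← MeasureTheory.integral_Icc_eq_integral_Ioc, ← himg,
    MeasureTheory.integral_image_eq_integral_abs_deriv_smul measurableSet_Icc
      (fun s _ => (hT s).hasDerivWithinAt) hmono.injective.injOn]
  have : ∀ s, |(R (T s))⁻¹| • R (T s) = 1 := fun s => by
    rw [abs_of_pos (inv_pos.2 (hR0 _)), smul_eq_mul, inv_mul_cancel₀ (hR0 _).ne']
  simp only [this]
  simp [hτ]

/-- If `T' = 1 / (R ∘ T)` with `R` continuous and positive, then `T → ∞`. -/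
theorem tendsto_atTop_of_inv_deriv {T R : ℝ → ℝ} (hmono : StrictMono T) (h0 : T 0 = 0)
    (hT : ∀ τ, HasDerivAt T (R (T τ))⁻¹ τ) (hR0 : ∀ s, 0 < R s) (hR : Continuous R) :
    Tendsto T atTop atTop := by
  refine tendsto_atTop_atTop_of_monotone hmono.monotone fun C => ?_
  by_contra! hcon
  -- A time larger than the integral of `R` up to `C`. If `T` stayed below `C`, then τ, the integral
  -- of `R` up to T τ, could not exceed that integral.
  set τ := max 0 ((∫ s in (0 : ℝ)..C, R s) + 1) with hτ
  have h1 := integral_comp_inv_deriv hmono h0 hT hR0 (le_max_left 0 _ : 0 ≤ τ)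
  have h2 : ∫ s in (0 : ℝ)..T τ, R s ≤ ∫ s in (0 : ℝ)..C, R s :=
    intervalIntegral.integral_mono_interval le_rfl (h0 ▸ hmono.monotone (le_max_left 0 _))
      (hcon τ).le (Eventually.of_forall fun s => (hR0 s).le) (hR.intervalIntegrable _ _)
  have h3 : (∫ s in (0 : ℝ)..C, R s) + 1 ≤ τ := le_max_right _ _
  linarith

/-- The average of `R` up to the time T τ equals τ / T τ, and T τ → ∞; it remains to invert. -/
theorem tendsto_inv_mul_of_average {T R : ℝ → ℝ} {a : ℝ} (hmono : StrictMono T) (h0 : T 0 = 0)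
    (hT : ∀ τ, HasDerivAt T (R (T τ))⁻¹ τ) (hR0 : ∀ s, 0 < R s) (hR : Continuous R)
    (ha : Tendsto (fun S : ℝ => S⁻¹ * ∫ s in (0 : ℝ)..S, R s) atTop (𝓝 a)) (ha0 : a ≠ 0) :
    Tendsto (fun τ : ℝ => τ⁻¹ * T τ) atTop (𝓝 a⁻¹) := by
  refine ((ha.comp (tendsto_atTop_of_inv_deriv hmono h0 hT hR0 hR)).inv₀ ha0).congr' ?_
  filter_upwards [eventually_ge_atTop 0] with τ hτ
  simp only [Function.comp_apply]
  rw [integral_comp_inv_deriv hmono h0 hT hR0 hτ, mul_inv, inv_inv, mul_comm]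

/-! ### Sorted lists -/

/-- The head of a sorted list is the least threshold at which the count is positive, so the heads
agree and can be removed. -/
theorem eq_of_countP_le_eq {l₁ l₂ : List ℝ} (h₁ : l₁.Pairwise (· ≤ ·)) (h₂ : l₂.Pairwise (· ≤ ·))
    (h : ∀ a : ℝ, l₁.countP (fun y => decide (y ≤ a)) = l₂.countP (fun y => decide (y ≤ a))) :
    l₁ = l₂ := by
  have key : ∀ {a : ℝ} {l : List ℝ} {b : ℝ}, (b :: l).Pairwise (· ≤ ·) →
      0 < (b :: l).countP (fun y => decide (y ≤ a)) → b ≤ a := by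
    intro a l b hl hpos
    obtain ⟨y, hy, hya⟩ := List.countP_pos_iff.1 hpos
    have hya : y ≤ a := by simpa using hya
    rcases List.mem_cons.1 hy with rfl | hy
    · exact hya
    · exact ((List.pairwise_cons.1 hl).1 y hy).trans hya
  induction l₁ generalizing l₂ with
  | nil =>
    cases l₂ with
    | nil => rfl
    | cons b l => have := h b; simp at this
  | cons c l₁ ih =>
    cases l₂ with
    | nil => have := h c; simp at this
    | cons b l₂ =>
      have hbc : b ≤ c := key h₂ (by rw [← h]; simp)
      have hcb : c ≤ b := key h₁ (by rw [h]; simp)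
      obtain rfl := le_antisymm hbc hcb
      rw [ih (List.pairwise_cons.1 h₁).2 (List.pairwise_cons.1 h₂).2 fun a => by
        have := h a
        simpa [List.countP_cons] using this]

/-! ### Differentials of a flow and of its time changes -/

section Flow

variable {n : ℕ} {M : Type*} [TopologicalSpace M]
  [ChartedSpace (EuclideanSpace ℝ (Fin n)) M]

/-- The differential of the time-`t` map, as an endomorphism of the model space. -/
def flowEnd (φ : ℝ → M → M) (t : ℝ) (x : M) :
    EuclideanSpace ℝ (Fin n) →L[ℝ] EuclideanSpace ℝ (Fin n) :=
  mfderiv (𝓡 n) (𝓡 n) (φ t) x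

/-- The vector field `f`, as a map to the model space. -/
def fieldVec (f : ∀ x : M, TangentSpace (𝓡 n) x) (x : M) : EuclideanSpace ℝ (Fin n) := f x

/-- Vanishing can be read in a local trivialization, where the component of `f` is continuous. -/
theorem isOpen_regularSet [IsManifold (𝓡 n) 1 M] {ℓ : WithTop ℕ∞}
    {f : ∀ x : M, TangentSpace (𝓡 n) x}
    (hf : IsCkVectorField ℓ f) : IsOpen (regularSet f) := by
  rw [isOpen_iff_mem_nhds]
  intro x hx
  let e := trivializationAt (EuclideanSpace ℝ (Fin n)) (TangentSpace (𝓡 n) : M → Type _) x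
  have hxe : x ∈ e.baseSet := mem_baseSet_trivializationAt _ _ x
  have hlin : ∀ y ∈ e.baseSet, ((e (⟨y, f y⟩ : TangentBundle (𝓡 n) M)).2 ≠ 0 ↔ f y ≠ 0) := by
    intro y hy
    have h1 : (e (⟨y, f y⟩ : TangentBundle (𝓡 n) M)).2 = e.continuousLinearEquivAt ℝ y hy (f y) :=
      rfl
    rw [h1, Ne, ContinuousLinearEquiv.map_eq_zero_iff]
  have hcont : ContinuousAt (fun y => (e (⟨y, f y⟩ : TangentBundle (𝓡 n) M)).2) x := by
    refine continuous_snd.continuousAt.comp (ContinuousAt.comp (g := e) ?_ hf.continuous.continuousAt)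
    exact e.continuousAt (e.mem_source.2 hxe)
  filter_upwards [hcont.eventually_ne ((hlin x hxe).2 hx), e.open_baseSet.mem_nhds hxe]
    with y hy hye
  exact (hlin y hye).1 hy

variable {ℓ : WithTop ℕ∞} {f : ∀ x : M, TangentSpace (𝓡 n) x} {φ : ℝ → M → M}

theorem IsCkFlowOn.contMDiff (hφ : IsCkFlowOn (n := n) ℓ φ univ) :
    ContMDiff (𝓘(ℝ, ℝ).prod (𝓡 n)) (𝓡 n) ℓ (fun q : ℝ × M => φ q.1 q.2) := by
  rw [← contMDiffOn_univ, ← univ_prod_univ]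
  exact hφ.contMDiffOn

theorem IsCkFlowOn.mdifferentiableAt {U : Set M} (hφ : IsCkFlowOn (n := n) ℓ φ U) (hU : IsOpen U)
    (hℓ : ℓ ≠ 0) (t : ℝ) {x : M} (hx : x ∈ U) : MDifferentiableAt (𝓡 n) (𝓡 n) (φ t) x := by
  have h1 : MDifferentiableAt (𝓘(ℝ, ℝ).prod (𝓡 n)) (𝓡 n) (fun q : ℝ × M => φ q.1 q.2) (t, x) :=
    (hφ.contMDiffOn.contMDiffAt ((isOpen_univ.prod hU).mem_nhds ⟨mem_univ _, hx⟩)).mdifferentiableAt hℓ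
  exact h1.comp x (mdifferentiableAt_const.prodMk mdifferentiableAt_id)

theorem flowEnd_injective (hφ : IsCkFlowOn (n := n) ℓ φ univ) (hℓ : ℓ ≠ 0) (t : ℝ) (x : M) :
    Function.Injective (flowEnd (n := n) φ t x) := by
  have h1 : (φ (-t)) ∘ (φ t) = id := by
    ext y
    simp only [Function.comp_apply, id_eq]
    rw [← hφ.add _ _ _ (mem_univ _), neg_add_cancel, hφ.zero _ (mem_univ _)]
  have h2 := mfderiv_comp (I := 𝓡 n) (I' := 𝓡 n) (I'' := 𝓡 n) x
    (hφ.mdifferentiableAt isOpen_univ hℓ (-t) (mem_univ (φ t x)))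
    (hφ.mdifferentiableAt isOpen_univ hℓ t (mem_univ x))
  rw [h1, mfderiv_id] at h2
  have h3 : ∀ v, flowEnd φ (-t) (φ t x) (flowEnd φ t x v) = v := fun v =>
    (congrArg (fun L : EuclideanSpace ℝ (Fin n) →L[ℝ] EuclideanSpace ℝ (Fin n) => L v) h2).symm
  exact Function.LeftInverse.injective h3

/-- If `γ` and `h ∘ γ` have velocities `v` and `w`, then the differential of `h` maps `v`
to `w`. -/
theorem mfderiv_apply_velocity {h : M → M} {γ : ℝ → M} {s : ℝ} {x : M}
    {v w : EuclideanSpace ℝ (Fin n)} (hs : γ s = x) (hh : MDifferentiableAt (𝓡 n) (𝓡 n) h x)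
    (hγ : HasMFDerivAt 𝓘(ℝ, ℝ) (𝓡 n) γ s ((1 : ℝ →L[ℝ] ℝ).smulRight v))
    (hhγ : HasMFDerivAt 𝓘(ℝ, ℝ) (𝓡 n) (h ∘ γ) s ((1 : ℝ →L[ℝ] ℝ).smulRight w)) :
    (mfderiv (𝓡 n) (𝓡 n) h x : EuclideanSpace ℝ (Fin n) →L[ℝ] EuclideanSpace ℝ (Fin n)) v = w := by
  subst hs
  have h1 := hasMFDerivAt_unique (hh.hasMFDerivAt.comp s hγ) hhγ
  have h2 : (mfderiv (𝓡 n) (𝓡 n) h (γ s) : EuclideanSpace ℝ (Fin n) →L[ℝ] EuclideanSpace ℝ (Fin n))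
      ((1 : ℝ) • v) = (1 : ℝ) • w :=
    congrArg (fun L : ℝ →L[ℝ] EuclideanSpace ℝ (Fin n) => L 1) h1
  rwa [one_smul, one_smul] at h2

/-- The map φ^t carries the orbit of `x` to the orbit of φ^t(x) with the same parameter, hence
velocity to velocity. -/
theorem flowEnd_fieldVec (hφ : IsCkFlowOn (n := n) ℓ φ univ) (hℓ : ℓ ≠ 0)
    (hφf : ∀ x, IsMIntegralCurve (I := 𝓡 n) (fun t => φ t x) f) (t : ℝ) (x : M) :
    flowEnd φ t x (fieldVec f x) = fieldVec f (φ t x) := by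
  have h0 := hφ.zero x (mem_univ _)
  have h0' := hφ.zero (φ t x) (mem_univ _)
  have h1 : HasMFDerivAt 𝓘(ℝ, ℝ) (𝓡 n) (fun s => φ s x) 0
      ((1 : ℝ →L[ℝ] ℝ).smulRight (fieldVec f (φ 0 x))) := hφf x 0
  have h2 : HasMFDerivAt 𝓘(ℝ, ℝ) (𝓡 n) (fun s => φ s (φ t x)) 0
      ((1 : ℝ →L[ℝ] ℝ).smulRight (fieldVec f (φ 0 (φ t x)))) := hφf (φ t x) 0
  rw [h0] at h1
  rw [h0'] at h2
  refine mfderiv_apply_velocity (γ := fun s => φ s x) h0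
    (hφ.mdifferentiableAt isOpen_univ hℓ t (mem_univ x)) h1 ?_
  have h3 : (φ t ∘ fun s => φ s x) = fun s => φ s (φ t x) := by
    ext s
    simp only [Function.comp_apply]
    rw [← hφ.add _ _ _ (mem_univ _), ← hφ.add _ _ _ (mem_univ _), add_comm]
  rw [h3]
  exact h2

theorem mem_regularSet_of_mem [IsManifold (𝓡 n) 1 M] (hφ : IsCkFlowOn (n := n) ℓ φ univ) (hℓ : ℓ ≠ 0)
    (hφf : ∀ x, IsMIntegralCurve (I := 𝓡 n) (fun t => φ t x) f) {x : M} (hx : x ∈ regularSet f)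
    (t : ℝ) : φ t x ∈ regularSet f := by
  have h1 : fieldVec f (φ t x) ≠ 0 := by
    rw [← flowEnd_fieldVec hφ hℓ hφf]
    exact fun h => hx (flowEnd_injective hφ hℓ t x (h.trans (map_zero _).symm))
  exact h1

end Flow

/-! ### Time changes: the generator r⁻¹ f and the differential -/

section Reparametrization

variable {n : ℕ} {M : Type*} [TopologicalSpace M]
  [ChartedSpace (EuclideanSpace ℝ (Fin n)) M]
  {ℓ : WithTop ℕ∞} {f : ∀ x : M, TangentSpace (𝓡 n) x} {φ ψ : ℝ → M → M} {t : M → ℝ → ℝ}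
  {r : M → ℝ} {U : Set M}

namespace IsTimeReparametrization

theorem time_zero (hψ : IsTimeReparametrization (n := n) ℓ φ ψ t r U) {x : M} (hx : x ∈ U) :
    t x 0 = 0 := by
  have h := hψ.cocycle x hx 0 0
  rw [hψ.isCkFlowOn.zero x hx, add_zero] at h
  linarith

/-- The cocycle identity t(x, s) = t(x, τ) + t(ψ^τ(x), s − τ) moves the derivative at τ to the
derivative at 0 at the point ψ^τ(x). -/
theorem hasDerivAt_time (hψ : IsTimeReparametrization (n := n) ℓ φ ψ t r U) {x : M} (hx : x ∈ U)
    (τ : ℝ) : HasDerivAt (t x) (r (φ (t x τ) x))⁻¹ τ := by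
  have h1 := hψ.hasDerivAt (ψ τ x) (hψ.isCkFlowOn.mapsTo τ hx)
  rw [← sub_self τ] at h1
  have h2 := (h1.comp_sub_const τ τ).const_add (t x τ)
  rw [← hψ.eq_flow x hx]
  refine h2.congr_of_eventuallyEq (Eventually.of_forall fun s => ?_)
  have := hψ.cocycle x hx τ (s - τ)
  rwa [add_sub_cancel] at this

theorem hasMFDerivAt_orbit (hψ : IsTimeReparametrization (n := n) ℓ φ ψ t r U)
    (hφ : IsCkFlowOn (n := n) ℓ φ univ)
    (hφf : ∀ x, IsMIntegralCurve (I := 𝓡 n) (fun t => φ t x) f) {x : M} (hx : x ∈ U) :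
    HasMFDerivAt 𝓘(ℝ, ℝ) (𝓡 n) (fun σ => ψ σ x) 0
      ((1 : ℝ →L[ℝ] ℝ).smulRight ((r x)⁻¹ • fieldVec f x)) := by
  have h0 := hφ.zero x (mem_univ _)
  have h1 : HasMFDerivAt 𝓘(ℝ, ℝ) (𝓡 n) (fun s => φ s x) (t x 0)
      ((1 : ℝ →L[ℝ] ℝ).smulRight (fieldVec f (φ (t x 0) x))) := hφf x (t x 0)
  have h2 := (hψ.hasDerivAt x hx).hasFDerivAt.hasMFDerivAt
  have h3 := h1.comp (0 : ℝ) h2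
  have h4 : (fun σ => ψ σ x) = (fun s => φ s x) ∘ t x := by
    ext σ
    exact hψ.eq_flow x hx σ
  rw [hψ.time_zero hx, h0] at h3
  rw [h4]
  refine h3.congr_mfderiv ?_
  have hD : ((1 : ℝ →L[ℝ] ℝ).smulRight (fieldVec f x)).comp
      (ContinuousLinearMap.toSpanSingleton ℝ (r x)⁻¹) =
      (1 : ℝ →L[ℝ] ℝ).smulRight ((r x)⁻¹ • fieldVec f x) := by
    ext1
    simp
  exact hD

/-- The velocity field of ψ is r⁻¹ f, and Dψ^τ preserves it; the factor compares `r` at the two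
ends. -/
theorem flowEnd_fieldVec (hψ : IsTimeReparametrization (n := n) ℓ φ ψ t r U)
    (hφ : IsCkFlowOn (n := n) ℓ φ univ) (hU : IsOpen U) (hℓ : ℓ ≠ 0)
    (hφf : ∀ x, IsMIntegralCurve (I := 𝓡 n) (fun t => φ t x) f) {x : M} (hx : x ∈ U) (τ : ℝ) :
    flowEnd ψ τ x (fieldVec f x) = (r x * (r (ψ τ x))⁻¹) • fieldVec f (ψ τ x) := by
  have h1 := hψ.hasMFDerivAt_orbit hφ hφf hx
  have h2 := hψ.hasMFDerivAt_orbit hφ hφf (hψ.isCkFlowOn.mapsTo τ hx)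
  have h3 : (ψ τ ∘ fun s => ψ s x) = fun s => ψ s (ψ τ x) := by
    ext s
    simp only [Function.comp_apply]
    rw [← hψ.isCkFlowOn.add _ _ _ hx, ← hψ.isCkFlowOn.add _ _ _ hx, add_comm]
  have h4 : flowEnd ψ τ x ((r x)⁻¹ • fieldVec f x) = (r (ψ τ x))⁻¹ • fieldVec f (ψ τ x) := by
    refine mfderiv_apply_velocity (γ := fun s => ψ s x) (hψ.isCkFlowOn.zero x hx)
      (hψ.isCkFlowOn.mdifferentiableAt hU hℓ τ hx) h1 ?_
    rw [h3]
    exact h2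
  rw [map_smul] at h4
  rw [mul_smul, ← h4, smul_smul, mul_inv_cancel₀ (hψ.r_pos x hx).ne', one_smul]

/-- The differential of the time change differs from that of the flow by a multiple of the
vector field. -/
theorem exists_flowEnd_eq (hψ : IsTimeReparametrization (n := n) ℓ φ ψ t r U)
    (hφ : IsCkFlowOn (n := n) ℓ φ univ) (hU : IsOpen U) (hℓ : ℓ ≠ 0)
    (hφf : ∀ x, IsMIntegralCurve (I := 𝓡 n) (fun t => φ t x) f) {x : M} (hx : x ∈ U) (τ : ℝ)
    (v : EuclideanSpace ℝ (Fin n)) :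
    ∃ s : ℝ, flowEnd ψ τ x v = flowEnd φ (t x τ) x v + s • fieldVec f (φ (t x τ) x) := by
  have ht : MDifferentiableAt (𝓡 n) 𝓘(ℝ, ℝ) (fun y => t y τ) x := by
    have h1 : MDifferentiableAt ((𝓡 n).prod 𝓘(ℝ, ℝ)) 𝓘(ℝ, ℝ) (fun q : M × ℝ => t q.1 q.2) (x, τ) :=
      (hψ.contMDiffOn.contMDiffAt ((hU.prod isOpen_univ).mem_nhds
        ⟨hx, mem_univ _⟩)).mdifferentiableAt hℓ
    exact h1.comp x (mdifferentiableAt_id.prodMk mdifferentiableAt_const)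
  have hΦ : MDifferentiableAt (𝓘(ℝ, ℝ).prod (𝓡 n)) (𝓡 n) (fun q : ℝ × M => φ q.1 q.2)
      (t x τ, x) := hφ.contMDiff.mdifferentiable hℓ _
  have hpair := ht.hasMFDerivAt.prodMk (hasMFDerivAt_id (I := 𝓡 n) x)
  -- Near `x`, ψ^τ is the joint flow map composed with y ↦ (t(y,τ), y). The partial differential in
  -- the time variable contributes the multiple of `f`, with the derivative of t(·,τ) along `v` as
  -- coefficient.
  have hcomp := HasMFDerivAt.comp (f := fun y => (t y τ, id y)) x hΦ.hasMFDerivAt hpair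
  have heq : ψ τ =ᶠ[𝓝 x] (fun q : ℝ × M => φ q.1 q.2) ∘ fun y => (t y τ, id y) := by
    filter_upwards [hU.mem_nhds hx] with y hy
    exact hψ.eq_flow y hy τ
  have hd := (hcomp.congr_of_eventuallyEq heq).mfderiv
  refine ⟨(mfderiv (𝓡 n) 𝓘(ℝ, ℝ) (fun y => t y τ) x : EuclideanSpace ℝ (Fin n) →L[ℝ] ℝ) v, ?_⟩
  have h1 : flowEnd ψ τ x v = (mfderiv (𝓘(ℝ, ℝ).prod (𝓡 n)) (𝓡 n) (fun q : ℝ × M => φ q.1 q.2)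
      (t x τ, x) : ℝ × EuclideanSpace ℝ (Fin n) →L[ℝ] EuclideanSpace ℝ (Fin n))
      ((mfderiv (𝓡 n) 𝓘(ℝ, ℝ) (fun y => t y τ) x : EuclideanSpace ℝ (Fin n) →L[ℝ] ℝ) v, v) :=
    congrArg (fun L : EuclideanSpace ℝ (Fin n) →L[ℝ] EuclideanSpace ℝ (Fin n) => L v) hd
  rw [h1]
  refine (mfderiv_prod_eq_add_apply hΦ).trans ?_
  rw [add_comm]
  refine congrArg₂ (fun a b : EuclideanSpace ℝ (Fin n) => a + b) rfl ?_
  have h2 : HasMFDerivAt 𝓘(ℝ, ℝ) (𝓡 n) (fun s => φ s x) (t x τ)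
      ((1 : ℝ →L[ℝ] ℝ).smulRight (fieldVec f (φ (t x τ) x))) := hφf x (t x τ)
  have h3 := h2.mfderiv
  exact congrArg (fun L : ℝ →L[ℝ] EuclideanSpace ℝ (Fin n) =>
    L ((mfderiv (𝓡 n) 𝓘(ℝ, ℝ) (fun y => t y τ) x : EuclideanSpace ℝ (Fin n) →L[ℝ] ℝ) v)) h3

/-- Along an orbit, 1/r is the partial derivative at σ = 0 of the C¹ function (s, σ) ↦ t(φ^s(x), σ)
on the plane. -/
theorem continuous_rate (hψ : IsTimeReparametrization (n := n) ℓ φ ψ t r U)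
    (hφ : IsCkFlowOn (n := n) ℓ φ univ) (hU : IsOpen U) (hℓ : 1 ≤ ℓ) {x : M}
    (hx : ∀ s, φ s x ∈ U) : Continuous fun s => r (φ s x) := by
  have h1 : ContMDiff 𝓘(ℝ, ℝ × ℝ) (𝓡 n) ℓ (fun q : ℝ × ℝ => φ q.1 x) :=
    hφ.contMDiff.comp ((contDiff_fst.contMDiff).prodMk contMDiff_const)
  have h2 : ContMDiff 𝓘(ℝ, ℝ × ℝ) 𝓘(ℝ, ℝ) ℓ (fun q : ℝ × ℝ => t (φ q.1 x) q.2) := by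
    intro q
    exact (hψ.contMDiffOn.contMDiffAt ((hU.prod isOpen_univ).mem_nhds
      ⟨hx q.1, mem_univ _⟩)).comp q (h1.prodMk contDiff_snd.contMDiff q)
  have h3 : ContDiff ℝ 1 (fun q : ℝ × ℝ => t (φ q.1 x) q.2) := (contMDiff_iff_contDiff.1 h2).of_le hℓ
  have h4 : ∀ s, fderiv ℝ (fun q : ℝ × ℝ => t (φ q.1 x) q.2) (s, 0) (0, 1) = (r (φ s x))⁻¹ := by
    intro s
    have h5 := ((h3.differentiable one_ne_zero (s, 0)).hasFDerivAt).comp_hasDerivAt (0 : ℝ)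
      ((hasDerivAt_const (0 : ℝ) s).prodMk (hasDerivAt_id (0 : ℝ)))
    exact h5.unique (hψ.hasDerivAt (φ s x) (hx s))
  have h6 : Continuous fun s => (r (φ s x))⁻¹ := by
    simp_rw [← h4]
    exact ((h3.continuous_fderiv one_ne_zero).comp (Continuous.prodMk_left 0)).clm_apply
      continuous_const
  exact (h6.inv₀ fun s => inv_ne_zero (hψ.r_pos _ (hx s)).ne').congr fun s => inv_inv _

end IsTimeReparametrization

end Reparametrization

/-! ### Regular bases from Lyapunov splittings -/

section Splitting

variable {n : ℕ} {M : Type*} [TopologicalSpace M]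
  [ChartedSpace (EuclideanSpace ℝ (Fin n)) M] [IsManifold (𝓡 n) 1 M] {p : WithTop ℕ∞}

/-- The metric at the point `y`, as a form on the model space. -/
def modelMetric (g : Metric n p M) (y : M) :
    EuclideanSpace ℝ (Fin n) →L[ℝ] EuclideanSpace ℝ (Fin n) →L[ℝ] ℝ :=
  g.inner y

/-- The pullback of the metric at the point `y` by a linear map `L` of the model space. -/
def pullForm (g : Metric n p M) (y : M)
    (L : EuclideanSpace ℝ (Fin n) →L[ℝ] EuclideanSpace ℝ (Fin n)) :
    EuclideanSpace ℝ (Fin n) →ₗ[ℝ] EuclideanSpace ℝ (Fin n) →ₗ[ℝ] ℝ :=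
  LinearMap.mk₂ ℝ (fun v w => modelMetric g y (L v) (L w))
    (fun _ _ _ => by simp only [map_add, add_apply])
    (fun _ _ _ => by simp only [map_smul, smul_apply])
    (fun _ _ _ => by simp only [map_add])
    (fun _ _ _ => by simp only [map_smul])

theorem pullForm_apply (g : Metric n p M) (y : M)
    (L : EuclideanSpace ℝ (Fin n) →L[ℝ] EuclideanSpace ℝ (Fin n))
    (v w : EuclideanSpace ℝ (Fin n)) :
    pullForm g y L v w = modelMetric g y (L v) (L w) :=
  rfl

theorem pullForm_symm (g : Metric n p M) (y : M)
    (L : EuclideanSpace ℝ (Fin n) →L[ℝ] EuclideanSpace ℝ (Fin n))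
    (v w : EuclideanSpace ℝ (Fin n)) : pullForm g y L v w = pullForm g y L w v :=
  g.symm y (L v) (L w)

theorem pullForm_pos (g : Metric n p M) (y : M)
    {L : EuclideanSpace ℝ (Fin n) →L[ℝ] EuclideanSpace ℝ (Fin n)} (hL : Function.Injective L)
    (v : EuclideanSpace ℝ (Fin n)) (hv : v ≠ 0) : 0 < pullForm g y L v v :=
  g.pos y (L v) fun h => hv (hL (h.trans (map_zero L).symm))

theorem tendsto_inv_mul_comp {u T : ℝ → ℝ} {a c : ℝ} (hT : Tendsto T atTop atTop)
    (hc : Tendsto (fun τ : ℝ => τ⁻¹ * T τ) atTop (𝓝 c))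
    (hu : Tendsto (fun s : ℝ => s⁻¹ * u s) atTop (𝓝 a)) :
    Tendsto (fun τ : ℝ => τ⁻¹ * u (T τ)) atTop (𝓝 (a * c)) := by
  refine ((hu.comp hT).mul hc).congr' ?_
  filter_upwards [hT.eventually_gt_atTop 0] with τ hτ
  simp only [Function.comp_apply]
  field_simp

namespace LyapunovSplitting

variable {g : Metric n p M} {φ : ℝ → M → M} {x : M}

theorem pairwise_exponentList (S : LyapunovSplitting g φ x) :
    S.exponentList.Pairwise (· ≤ ·) := by
  rw [exponentList, List.pairwise_flatMap]
  refine ⟨fun i _ => List.pairwise_replicate.2 (Or.inr le_rfl), ?_⟩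
  refine (List.pairwise_lt_finRange S.k).imp fun {i j} hij a ha b hb => ?_
  rw [List.eq_of_mem_replicate ha, List.eq_of_mem_replicate hb]
  exact (S.χ_strictMono hij).le

theorem countP_exponentList (S : LyapunovSplitting g φ x) (a : ℝ) :
    S.exponentList.countP (fun y => decide (y ≤ a)) =
      (Finset.univ.filter fun k : Σ i : Fin S.k, Fin (Module.finrank ℝ (S.E i)) =>
        S.χ k.1 ≤ a).card := by
  rw [exponentList, List.countP_flatMap, Finset.card_filter, Fintype.sum_sigma, ← List.sum_ofFn,
    List.ofFn_eq_map]
  congr 1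
  refine List.map_congr_left fun i _ => ?_
  by_cases h : S.χ i ≤ a <;> simp [List.countP_replicate, h]

/-- The splitting at a Lyapunov regular point provides, along a change of time `T` with
`T τ / τ → c`, a regular basis whose exponents are those of the splitting multiplied by `c`. -/
theorem exists_isRegularBasis (S : LyapunovSplitting g φ x) {T : ℝ → ℝ} {c : ℝ}
    (hT : Tendsto T atTop atTop) (hc : Tendsto (fun τ : ℝ => τ⁻¹ * T τ) atTop (𝓝 c))
    (hinj : ∀ s, Function.Injective (flowEnd (n := n) φ s x)) :
    ∃ (b : Module.Basis (Fin n) ℝ (EuclideanSpace ℝ (Fin n))) (e : Fin n → ℝ),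
      IsRegularBasis (fun τ => pullForm g (φ (T τ) x) (flowEnd φ (T τ) x)) b (fun i => e i * c) ∧
      ∀ a, S.exponentList.countP (fun y => decide (y ≤ a)) =
        (Finset.univ.filter fun k => e k ≤ a).card := by
  have : Module.Finite ℝ (TangentSpace (𝓡 n) x) :=
    inferInstanceAs (Module.Finite ℝ (EuclideanSpace ℝ (Fin n)))
  let std : Module.Basis (Fin n) ℝ (EuclideanSpace ℝ (Fin n)) :=
    (EuclideanSpace.basisFun (Fin n) ℝ).toBasis
  have hstd : ∀ i, std i = EuclideanSpace.single i (1 : ℝ) := fun i => by simp [std]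
  let b₀ : Module.Basis (Σ i : Fin S.k, Fin (Module.finrank ℝ (S.E i))) ℝ
      (EuclideanSpace ℝ (Fin n)) :=
    -- A basis adapted to the splitting: each of its vectors lies in some `S.E i` and grows exactly
    -- at rate `S.χ i`.
    S.isInternal.collectedBasis fun i => Module.finBasis ℝ (S.E i)
  have hb₀ : ∀ k, b₀ k ∈ S.E k.1 := fun k => S.isInternal.collectedBasis_mem _ k
  let σ := b₀.indexEquiv std
  have hnorm : ∀ s v, riemNorm g (flowDeriv φ s x v) =
      Real.sqrt (pullForm g (φ s x) (flowEnd φ s x) v v) := fun s v => rfl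
  have hvol : ∀ s, absDet g (flowDeriv φ s x) =
      Real.sqrt (gramDet (pullForm g (φ s x) (flowEnd φ s x)) std) /
        Real.sqrt (gramDet (pullForm g x (ContinuousLinearMap.id ℝ _)) std) := by
    intro s
    have h : (std : Fin n → EuclideanSpace ℝ (Fin n)) = fun i => EuclideanSpace.single i (1 : ℝ) :=
      funext hstd
    rw [h]
    rfl
  have hgd : ∀ s, 0 < gramDet (pullForm g (φ s x) (flowEnd φ s x)) std := fun s =>
    gramDet_pos (pullForm_symm g _ _) (pullForm_pos g _ (hinj s)) std
  have hgd0 : 0 < gramDet (pullForm g x (ContinuousLinearMap.id ℝ _)) std :=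
    gramDet_pos (pullForm_symm g _ _) (pullForm_pos g _ Function.injective_id) std
  set C := Real.sqrt (gramDet (pullForm g x (ContinuousLinearMap.id ℝ _)) std) with hC
  have hCpos : 0 < C := Real.sqrt_pos.2 hgd0
  refine ⟨b₀.reindex σ, fun i => S.χ (σ.symm i).1, ⟨fun τ => pullForm_symm g _ _, ?_, ?_, ?_⟩, ?_⟩
  · intro τ v
    rcases eq_or_ne v 0 with rfl | hv
    · simp
    · exact (pullForm_pos g _ (hinj (T τ)) v hv).le
  · intro i
    rw [Module.Basis.reindex_apply]
    have hne : b₀ (σ.symm i) ≠ 0 := b₀.ne_zero _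
    refine growthLE_of_tendsto
      (fun τ => Real.sqrt_pos.2 (pullForm_pos g _ (hinj (T τ)) _ hne)) ?_
    exact tendsto_inv_mul_comp
      (u := fun s => Real.log (Real.sqrt (pullForm g (φ s x) (flowEnd φ s x)
        (b₀ (σ.symm i)) (b₀ (σ.symm i))))) hT hc
      (S.tendsto_atTop (σ.symm i).1 _ (hb₀ _) hne)
  · have hsum : ∑ i, S.χ (σ.symm i).1 * c =
        (∑ i, (Module.finrank ℝ (S.E i) : ℝ) * S.χ i) * c := by
      rw [← Finset.sum_mul, Equiv.sum_comp σ.symm fun k => S.χ k.1, Fintype.sum_sigma]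
      simp
    rw [hsum]
    have h1 := growthGE_of_tendsto (u := fun τ => absDet g (flowDeriv φ (T τ) x))
      (fun τ => by
        rw [hvol]
        exact div_pos (Real.sqrt_pos.2 (hgd _)) hCpos)
      (tendsto_inv_mul_comp (u := fun s => Real.log (absDet g (flowDeriv φ s x))) hT hc
        S.det_atTop)
    -- The regularity limit concerns the standard frame; passing to the adapted basis costs the
    -- constant |d|, and `C` is the volume of the standard frame at `x`.
    set d := std.det (b₀.reindex σ) with hd
    have hd0 : 0 < |d| := abs_pos.2 (std.isUnit_det (b₀.reindex σ)).ne_zero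
    have h2 := GrowthGE.of_mul
      (u := fun τ => Real.sqrt (gramDet (pullForm g (φ (T τ) x) (flowEnd φ (T τ) x))
        (b₀.reindex σ))) (v := fun _ => |d|⁻¹ * C⁻¹)
      (h1.mono_fun fun τ => le_of_eq (by
        rw [hvol, gramDet_eq_det_sq_mul _ std (b₀.reindex σ), Real.sqrt_mul (sq_nonneg _),
          Real.sqrt_sq_eq_abs, ← hd]
        field_simp))
      (growthLE_const _) fun τ => Real.sqrt_nonneg _
    simpa using h2
  · intro a
    rw [S.countP_exponentList]
    refine Finset.card_bij (fun k _ => σ k) (fun k hk => ?_) (fun k _ l _ h => σ.injective h)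
      fun i hi => ⟨σ.symm i, ?_, by simp⟩
    · simpa using hk
    · simpa using hi

end LyapunovSplitting

end Splitting

/-! ### Comparison of the two spectra -/

section Comparison

variable {n : ℕ} {M : Type*} [TopologicalSpace M]
  [ChartedSpace (EuclideanSpace ℝ (Fin n)) M] [IsManifold (𝓡 n) 1 M] {p ℓ : WithTop ℕ∞}
  {f : ∀ x : M, TangentSpace (𝓡 n) x} {φ ψ : ℝ → M → M} {t : M → ℝ → ℝ} {r : M → ℝ}
  {g : Metric n p M} {x : M}

/-- At a point that is Lyapunov regular for a flow and for a time change of it, the lists of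
exponents are proportional, with the forward average of the rate as the factor. -/
theorem map_exponentList_eq (hℓ : 1 ≤ ℓ) (hf : IsCkVectorField ℓ f)
    (hφ : IsCkFlowOn (n := n) ℓ φ univ)
    (hφf : ∀ x, IsMIntegralCurve (I := 𝓡 n) (fun t => φ t x) f)
    (hψ : IsTimeReparametrization (n := n) ℓ φ ψ t r (regularSet f))
    (S : LyapunovSplitting g φ x) (S' : LyapunovSplitting g ψ x) (hx : x ∈ regularSet f)
    {a : ℝ} (ha : IsForwardAverage φ r x a) (ha0 : 0 < a) :
    S'.exponentList.map (· * a) = S.exponentList := by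
  have hℓ0 : ℓ ≠ 0 := (zero_lt_one.trans_le hℓ).ne'
  have hU := isOpen_regularSet hf
  have horb : ∀ s, φ s x ∈ regularSet f := mem_regularSet_of_mem hφ hℓ0 hφf hx
  have hR0 : ∀ s, 0 < r (φ s x) := fun s => hψ.r_pos _ (horb s)
  have hRc := hψ.continuous_rate hφ hU hℓ horb
  have hT := hψ.hasDerivAt_time hx
  have hT0 := hψ.time_zero hx
  have hTmono := hψ.strictMono x hx
  have hTtop := tendsto_atTop_of_inv_deriv (R := fun s => r (φ s x)) hTmono hT0 hT hR0 hRc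
  have hTlim := tendsto_inv_mul_of_average (R := fun s => r (φ s x)) hTmono hT0 hT hR0 hRc ha
    ha0.ne'
  set F := fieldVec f x with hF
  have hF0 : F ≠ 0 := hx
  have hAinj := fun s => flowEnd_injective hφ hℓ0 s x
  have hAF : ∀ s, flowEnd φ s x F = fieldVec f (φ s x) := fun s => flowEnd_fieldVec hφ hℓ0 hφf s x
  have hκ : ∀ τ, 0 < r x * (r (φ (t x τ) x))⁻¹ := fun τ =>
    mul_pos (hψ.r_pos x hx) (inv_pos.2 (hR0 _))
  have hBF : ∀ τ, flowEnd ψ τ x F =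
      (r x * (r (φ (t x τ) x))⁻¹) • flowEnd φ (t x τ) x F := fun τ => by
    rw [hψ.flowEnd_fieldVec hφ hU hℓ0 hφf hx, hAF, hψ.eq_flow x hx]
  have hBA : ∀ τ v, ∃ s : ℝ, flowEnd ψ τ x v = flowEnd φ (t x τ) x (v + s • F) := fun τ v => by
    obtain ⟨s, hs⟩ := hψ.exists_flowEnd_eq hφ hU hℓ0 hφf hx τ v
    exact ⟨s, by rw [hs, map_add, map_smul, hAF]⟩
  have hAB : ∀ τ v, ∃ s : ℝ, flowEnd ψ τ x (v + s • F) = flowEnd φ (t x τ) x v := fun τ v => by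
    obtain ⟨s, hs⟩ := hBA τ v
    -- On `F` the differential of ψ is that of φ times r(x) / r(φ^{t(x,τ)}(x)), so the correction is
    -- divided by this factor.
    refine ⟨-(s / (r x * (r (φ (t x τ) x))⁻¹)), ?_⟩
    rw [map_add, map_smul, hs, hBF, smul_smul, neg_mul, div_mul_cancel₀ _ (hκ τ).ne', map_add,
      map_smul, neg_smul, add_neg_cancel_right]
  -- A kernel vector of Dψ^τ must be a multiple of `F`, and Dψ^τ does not kill `F`.
  have hBinj : ∀ τ, Function.Injective (flowEnd (n := n) ψ τ x) := fun τ => by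
    refine (injective_iff_map_eq_zero _).2 fun v hv => ?_
    obtain ⟨s, hs⟩ := hBA τ v
    have h1 : v + s • F = 0 := hAinj (t x τ) (by rw [← hs, hv, map_zero])
    have h2 : v = -(s • F) := eq_neg_of_add_eq_zero_left h1
    have h3 : s • ((r x * (r (φ (t x τ) x))⁻¹) • flowEnd φ (t x τ) x F) = 0 := by
      rw [← hBF, ← map_smul, ← neg_eq_zero, ← map_neg, ← h2, hv]
    have h4 : flowEnd φ (t x τ) x F ≠ 0 := fun h =>
      hF0 (hAinj (t x τ) (h.trans (map_zero _).symm))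
    have h5 : s = 0 := by
      simpa [(hκ τ).ne', h4, (hψ.r_pos x hx).ne', (hR0 (t x τ)).ne'] using h3
    rw [h2, h5, zero_smul, neg_zero]
  obtain ⟨b, e, hb, hcount⟩ := S.exists_isRegularBasis hTtop hTlim hAinj
  -- ψ is taken in its own time, so the change of time is the identity with `c = 1`; φ above is read
  -- in the time τ, with factor `a⁻¹`.
  obtain ⟨b', e', hb', hcount'⟩ := S'.exists_isRegularBasis (T := id) (c := 1) tendsto_id
    (tendsto_const_nhds.congr' (by
      filter_upwards [eventually_ne_atTop 0] with τ hτ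
      exact (inv_mul_cancel₀ hτ).symm)) hBinj
  simp only [id, mul_one] at hb'
  obtain ⟨b, i, hb, hbi⟩ := hb.exists_mem hF0
  obtain ⟨b', j, hb', hbj⟩ := hb'.exists_mem hF0
  have he : e i * a⁻¹ = e' j := by
    have h1 := hb.growthLE i
    have h2 := hb.growthGE_basis i
    have h3 := hb'.growthLE j
    have h4 := hb'.growthGE_basis j
    rw [hbi] at h1 h2
    rw [hbj] at h3 h4
    -- The two norms of the image of `F` differ by the factor r(x) / r(φ^{t(x,τ)}(x)), which is r(x)
    -- times the derivative of `t x` at τ.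
    refine growth_rate_eq hT (fun τ => inv_pos.2 (hR0 _)) hTlim (inv_pos.2 ha0)
      (hψ.r_pos x hx) (fun τ => ?_) h1 h2 h3 h4
    rw [pullForm_apply, pullForm_apply, hBF, hψ.eq_flow x hx τ]
    simp only [map_smul, smul_apply, smul_eq_mul]
    rw [← mul_assoc, Real.sqrt_mul (mul_self_nonneg _), Real.sqrt_mul_self (hκ τ).le]
  have hcard := hb.card_eq hb' (hbi.trans hbj.symm) he
    (fun τ v => by
      obtain ⟨s, hs⟩ := hAB τ v
      refine ⟨s, ?_⟩
      rw [hbj, pullForm_apply, pullForm_apply, hs, hψ.eq_flow x hx τ])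
    (fun τ v => by
      obtain ⟨s, hs⟩ := hBA τ v
      refine ⟨s, ?_⟩
      rw [hbi, pullForm_apply, pullForm_apply, hs, hψ.eq_flow x hx τ])
  refine eq_of_countP_le_eq ?_ S.pairwise_exponentList fun c => ?_
  · rw [List.pairwise_map]
    exact S'.pairwise_exponentList.imp fun h => mul_le_mul_of_nonneg_right h ha0.le
  -- In the time τ the exponents of φ are `e k * a⁻¹`, so the threshold `c` becomes `c * a⁻¹`.
  · have h1 := hcard (c * a⁻¹)
    simp only [mul_le_mul_iff_left₀ (inv_pos.2 ha0)] at h1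
    rw [hcount, h1, ← hcount', List.countP_map]
    congr 1
    ext y
    simp [← div_eq_mul_inv, le_div_iff₀ ha0]

theorem exponent_mul_eq {S : LyapunovSplitting g φ x} {S' : LyapunovSplitting g ψ x} {a : ℝ}
    (h : S'.exponentList.map (· * a) = S.exponentList) (i : Fin n) :
    S'.exponent i * a = S.exponent i := by
  simp only [LyapunovSplitting.exponent, List.get_eq_getElem, Fin.val_cast, ← h,
    List.getElem_map]

end Comparison

end TimeChange

end

theorem mainTheorem1 {n : ℕ} {m ℓ : ℕ∞} (hm : 2 ≤ m) (hℓ : 1 ≤ ℓ) (hℓm : ℓ < m)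
    {M : Type*} [TopologicalSpace M] [T2Space M]
    [ChartedSpace (EuclideanSpace ℝ (Fin n)) M]
    [IsManifold (𝓡 n) 1 M] [IsManifold (𝓡 n) m M]
    (g : TimeChange.Metric n ((m - 1 : ℕ∞) : WithTop ℕ∞) M)
    (f : ∀ x : M, TangentSpace (𝓡 n) x) (hf : TimeChange.IsCkVectorField ℓ f)
    (φ : ℝ → M → M) (hφ : TimeChange.IsCkFlowOn (n := n) ℓ φ Set.univ)
    (hφf : ∀ x, IsMIntegralCurve (I := 𝓡 n) (fun t => φ t x) f)
    (ψ : ℝ → M → M) (t : M → ℝ → ℝ) (r : M → ℝ)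
    (hψ : TimeChange.IsTimeReparametrization (n := n) ℓ φ ψ t r (TimeChange.regularSet f))
    (x : M) (S : TimeChange.LyapunovSplitting g φ x) (S' : TimeChange.LyapunovSplitting g ψ x)
    (hx : TimeChange.HasSimpleFlowExponent f S)
    (rPlus : ℝ) (hrPlus : TimeChange.IsForwardAverage φ r x rPlus) (hrPlus_pos : 0 < rPlus) :
    (∀ i : Fin n, S'.exponent i * rPlus = S.exponent i) ∧
      Nat.card {i : Fin n // 0 < S'.exponent i} = Nat.card {i : Fin n // 0 < S.exponent i} ∧
      Nat.card {i : Fin n // S'.exponent i = 0} = Nat.card {i : Fin n // S.exponent i = 0} ∧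
      Nat.card {i : Fin n // S'.exponent i < 0} = Nat.card {i : Fin n // S.exponent i < 0} := by
  have hmul : ∀ i : Fin n, S'.exponent i * rPlus = S.exponent i :=
    TimeChange.exponent_mul_eq (TimeChange.map_exponentList_eq (ℓ := (ℓ : WithTop ℕ∞))
      (by exact_mod_cast hℓ) hf hφ hφf hψ S S' hx.1 hrPlus hrPlus_pos)
  refine ⟨hmul, ?_, ?_, ?_⟩ <;>
    refine Nat.card_congr (Equiv.subtypeEquivRight fun i => ?_) <;> rw [← hmul i]
  · exact (mul_pos_iff_of_pos_right hrPlus_pos).symm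
  · simp [hrPlus_pos.ne']
  · rw [← not_le, ← not_le, mul_nonneg_iff_of_pos_right hrPlus_pos]
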